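/- **Definitions.** For mass problems $\mathcal A,\mathcal B\subseteq\omega^\omega$ let $\mathcal A\le\mathcal B$ if there is a single oracle Turing machine which, given any $g\in\mathcal B$ as oracle, computes a function in $\mathcal A$. The equivalence classes of mass problems under the induced equivalence form the Medvedev lattice $\mathfrak M$. It is a Brouwer algebra: a bounded distributive lattice with join $+$, meet $\times$, and an operation $\mathbf a\to\mathbf b=$ the least $\mathbf c$ with $\mathbf b\le\mathbf a+\mathbf c$. For $\mathbf A\in\mathfrak M$, the initial segment $\mathfrak M/\mathbf A=\{\mathbf B\in\mathfrak M:\mathbf B\le\mathbf A\}$ is a Brouwer algebra with the same $+,\times,\to$, top element $1=\mathbf A$ and $\neg\mathbf B=\mathbf B\to\mathbf A$. For a Brouwer algebra $L$, $\mathrm{Th}(L)$ is the set of propositional formulas (in $\vee,\wedge,\to,\neg$) that take the value $0$ under every assignment of elements of $L$ to the variables, where $\vee,\wedge,\to,\neg$ are interpreted by $\times,+,\to,\neg$ respectively. Let $\varphi_1=\neg p_1\vee\neg\neg p_1$, for $k>1$ let $$\varphi_k=\bigvee_{1\le i,j\le k,\ i\ne j}(\neg p_i\to\neg p_j)\ \vee\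 \neg(\neg p_1\wedge\dots\wedge\neg p_k),$$ and for $n\ge1$ let $$\sigma_n=\bigwedge_{0\le i<j\le n}\neg(\neg p_i\wedge\neg p_j)\ \to\ \bigvee_{0\le i\le n}\Big(\neg p_i\to\bigvee_{j\ne i}\neg p_j\Big).$$ **Statement.** Let $\{f_i:i\in\omega\}$ be functions $f_i\in\omega^\omega$ whose Turing degrees are pairwise incomparable, let $\mathbf B_{f}$ be the Medvedev degree of $\{g\in\omega^\omega: g\not\le_T f\}$, and for $n\in\omega$ let $\mathbf B_n=\mathbf B_{f_1}+\dots+\mathbf B_{f_n}$ (with $\mathbf B_0=0$, the empty join). Then: 1. If $m\ne n$, then $\mathrm{Th}(\mathfrak M/\mathbf B_m)\ne\mathrm{Th}(\mathfrak M/\mathbf B_n)$. 2. If $1\le n<m$ and $k=\binom{n}{\lfloor n/2\rfloor}$, then $\varphi_k\in\mathrm{Th}(\mathfrak M/\mathbf B_n)$ and $\varphi_k\notin\mathrm{Th}(\mathfrak M/\mathbf B_m)$; likewise $\sigma_n\in\mathrm{Th}(\mathfrak M/\mathbf B_n)$ and $\sigma_n\notin\mathrm{Th}(\mathfrak M/\mathbf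 B_m)$. -/

import Mathlib

/-! ## Propositional formulas and their interpretation in Brouwer algebras -/

/-- Formulas of propositional logic over the variables `p₀, p₁, …` with the connectives
`∧`, `∨`, `→`, `¬`. -/
inductive PropFormula : Type
  | var : ℕ → PropFormula
  | and : PropFormula → PropFormula → PropFormula
  | or : PropFormula → PropFormula → PropFormula
  | imp : PropFormula → PropFormula → PropFormula
  | neg : PropFormula → PropFormula

namespace PropFormula

/-- Finite disjunction. The disjunction of one formula is that formula; the empty disjunction
(which does not occur in the formulas below) is a contradiction. -/
def bigOr : List PropFormula → PropFormula
  | [] => neg (imp (var 0) (var 0))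
  | [a] => a
  | a :: b :: l => or a (bigOr (b :: l))

/-- Finite conjunction. The conjunction of one formula is that formula; the empty conjunction
(which does not occur in the formulas below) is a tautology. -/
def bigAnd : List PropFormula → PropFormula
  | [] => imp (var 0) (var 0)
  | [a] => a
  | a :: b :: l => and a (bigAnd (b :: l))

/-- The formula `φ_k`, `k ≥ 1`: `φ₁ = ¬p₁ ∨ ¬¬p₁`, and for `k > 1`
`φ_k = ⋁_{i ≠ j} (¬p_i → ¬p_j) ∨ ¬(¬p₁ ∧ … ∧ ¬p_k)`, where `i, j` range over `1, …, k`. -/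
def phi (k : ℕ) : PropFormula :=
  if k = 1 then or (neg (var 1)) (neg (neg (var 1)))
  else
    or
      (bigOr ((((List.range' 1 k) ×ˢ (List.range' 1 k)).filter fun q => q.1 ≠ q.2).map
        fun q => imp (neg (var q.1)) (neg (var q.2))))
      (neg (bigAnd ((List.range' 1 k).map fun i => neg (var i))))

/-- The formula `σ_k`, `k ≥ 1`:
`σ_k = ⋀_{0 ≤ i < j ≤ k} ¬(¬p_i ∧ ¬p_j) → ⋁_{0 ≤ i ≤ k} (¬p_i → ⋁_{j ≠ i} ¬p_j)`. -/
def sigma (k : ℕ) : PropFormula :=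
  imp
    (bigAnd ((((List.range (k + 1)) ×ˢ (List.range (k + 1))).filter fun q => q.1 < q.2).map
      fun q => neg (and (neg (var q.1)) (neg (var q.2)))))
    (bigOr ((List.range (k + 1)).map fun i =>
      imp (neg (var i))
        (bigOr (((List.range (k + 1)).filter fun j => j ≠ i).map fun j => neg (var j)))))

/-- The value of a formula in a Brouwer algebra (in Mathlib: co-Heyting algebra) `L` under the
assignment `v`: `∧` is the join, `∨` is the meet, `a → b` is the least `c` with `b ≤ a + c`
(in Mathlib: `b \ a`), and `¬ a` is `a → 1`. -/
def eval {L : Type*} [CoheytingAlgebra L] (v : ℕ → L) : PropFormula → L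
  | var i => v i
  | and a b => eval v a ⊔ eval v b
  | or a b => eval v a ⊓ eval v b
  | imp a b => eval v b \ eval v a
  | neg a => ⊤ \ eval v a

end PropFormula

/-- The theory `Th(L)` of a Brouwer algebra `L`: the formulas that take the value `0` under all
assignments. -/
def brouwerTheory (L : Type*) [CoheytingAlgebra L] : Set PropFormula :=
  {s | ∀ v : ℕ → L, s.eval v = ⊥}

/-- The initial segment `L/A` of all `B ≤ A` of a Brouwer algebra `L` is a Brouwer algebra with the
operations of `L` and top element `A`. -/
instance Set.Iic.instCoheytingAlgebra {L : Type*} [CoheytingAlgebra L] (A : L) :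
    CoheytingAlgebra (Set.Iic A) where
  sdiff b a := ⟨(b : L) \ (a : L), sdiff_le.trans b.2⟩
  sdiff_le_iff a b c := by
    change (a : L) \ (b : L) ≤ (c : L) ↔ (a : L) ≤ (b : L) ⊔ (c : L)
    exact sdiff_le_iff
  hnot a := ⟨A \ (a : L), sdiff_le⟩
  top_sdiff _ := rfl

/-! ## Oracle computations -/

/-- Programs for partial recursive functions on `ℕ` with an oracle: the constant zero, successor,
the projections of the pairing function, a query to the oracle, pairing, composition, primitive
recursion, and unbounded search. -/
inductive OracleCode : Type
  | zero : OracleCode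
  | succ : OracleCode
  | left : OracleCode
  | right : OracleCode
  | oracle : OracleCode
  | pair : OracleCode → OracleCode → OracleCode
  | comp : OracleCode → OracleCode → OracleCode
  | prec : OracleCode → OracleCode → OracleCode
  | rfind : OracleCode → OracleCode

namespace OracleCode

/-- The partial function computed by a program when given the oracle `g : ℕ → ℕ`. The clauses are
those of `Nat.RecursiveIn`. -/
def eval (g : ℕ → ℕ) : OracleCode → ℕ → Part ℕ
  | zero, _ => Part.some 0
  | succ, n => Part.some (n + 1)
  | left, n => Part.some n.unpair.1
  | right, n => Part.some n.unpair.2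
  | oracle, n => Part.some (g n)
  | pair c d, n => (eval g c n).bind fun a => (eval g d n).bind fun b => Part.some (Nat.pair a b)
  | comp c d, n => (eval g d n).bind (eval g c)
  | prec c d, p =>
      Nat.rec (eval g c p.unpair.1)
        (fun y ih => ih.bind fun i => eval g d (Nat.pair p.unpair.1 (Nat.pair y i))) p.unpair.2
  | rfind c, a => Nat.rfind fun n => (eval g c (Nat.pair a n)).map fun m => decide (m = 0)

theorem mem_eval_rfind {g : ℕ → ℕ} {c : OracleCode} {a y : ℕ} :
    y ∈ eval g (rfind c) a ↔ 0 ∈ eval g c (Nat.pair a y) ∧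
      ∀ m < y, ∃ v, v + 1 ∈ eval g c (Nat.pair a m) := by
  refine Nat.mem_rfind.trans (and_congr ?_ (forall_congr' fun m => ?_))
  · refine (Part.mem_map_iff _).trans ⟨?_, fun h => ⟨0, h, by simp⟩⟩
    rintro ⟨v, hv, h⟩
    obtain rfl : v = 0 := by simpa using h
    exact hv
  · refine forall_congr' fun _ => (Part.mem_map_iff _).trans ⟨?_, ?_⟩
    · rintro ⟨v, hv, h⟩
      obtain ⟨w, rfl⟩ : ∃ w, v = w + 1 := Nat.exists_eq_succ_of_ne_zero (by simpa using h)
      exact ⟨w, hv⟩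
    · rintro ⟨v, hv⟩
      exact ⟨v + 1, hv, by simp⟩

/-- Replace the oracle queries of `c` by runs of `d`. -/
def subst (d : OracleCode) : OracleCode → OracleCode
  | zero => zero
  | succ => succ
  | left => left
  | right => right
  | oracle => d
  | pair a b => pair (subst d a) (subst d b)
  | comp a b => comp (subst d a) (subst d b)
  | prec a b => prec (subst d a) (subst d b)
  | rfind a => rfind (subst d a)

theorem eval_subst {d : OracleCode} {g f : ℕ → ℕ} (h : ∀ n, eval g d n = Part.some (f n))
    (c : OracleCode) : eval g (subst d c) = eval f c := by
  induction c with
  | oracle => funext n; simp [subst, eval, h]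
  | pair a b iha ihb => funext n; simp [subst, eval, iha, ihb]
  | comp a b iha ihb => funext n; simp [subst, eval, iha, ihb]
  | prec a b iha ihb => funext n; simp [subst, eval, iha, ihb]
  | rfind a iha => funext n; simp [subst, eval, iha]
  | _ => rfl

/-- Every ordinary partial recursive function has a program that ignores the oracle. -/
theorem exists_of_partrec {f : ℕ →. ℕ} (hf : Nat.Partrec f) :
    ∃ c : OracleCode, ∀ g, eval g c = f := by
  induction hf with
  | zero => exact ⟨zero, fun g => rfl⟩
  | succ => exact ⟨succ, fun g => rfl⟩
  | left => exact ⟨left, fun g => rfl⟩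
  | right => exact ⟨right, fun g => rfl⟩
  | pair _ _ ih₁ ih₂ =>
    obtain ⟨c, hc⟩ := ih₁
    obtain ⟨d, hd⟩ := ih₂
    refine ⟨pair c d, fun g => ?_⟩
    funext n
    simp [eval, hc, hd, Seq.seq, Part.bind_map, Part.bind_some_eq_map]
  | comp _ _ ih₁ ih₂ =>
    obtain ⟨c, hc⟩ := ih₁
    obtain ⟨d, hd⟩ := ih₂
    exact ⟨comp c d, fun g => by funext n; simp only [eval, hc, hd]; rfl⟩
  | prec _ _ ih₁ ih₂ =>
    obtain ⟨c, hc⟩ := ih₁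
    obtain ⟨d, hd⟩ := ih₂
    exact ⟨prec c d, fun g => by funext n; simp [eval, hc, hd, Nat.unpaired]⟩
  | rfind _ ih =>
    obtain ⟨c, hc⟩ := ih
    exact ⟨rfind c, fun g => by funext n; simp [eval, hc]⟩

theorem exists_of_computable {f : ℕ → ℕ} (hf : Computable f) :
    ∃ c : OracleCode, ∀ g n, eval g c n = Part.some (f n) := by
  obtain ⟨c, hc⟩ := exists_of_partrec (Partrec.nat_iff.1 hf)
  exact ⟨c, fun g n => by rw [hc]; rfl⟩

/-! ### Approximations along finite initial segments of the oracle, and a universal program -/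

/-- One step of a bounded search for the least zero. -/
def searchStep (r : ℕ → Option ℕ) (x : ℕ) : ℕ :=
  if (r x).getD 0 = 0 then x else x + 1

/-- The computation of `c` with a finite string `l` as an oracle, in which searches are bounded by
the length of the string; `none` if the string is too short. -/
def approx : OracleCode → List ℕ → ℕ → Option ℕ
  | zero, _, _ => some 0
  | succ, _, n => some (n + 1)
  | left, _, n => some n.unpair.1
  | right, _, n => some n.unpair.2
  | oracle, l, n => l.reverse[n]?
  | pair c d, l, n => (approx c l n).bind fun a => (approx d l n).bind fun b => some (Nat.pair a b)
  | comp c d, l, n => (approx d l n).bind (approx c l)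
  | prec c d, l, p =>
      Nat.rec (approx c l p.unpair.1)
        (fun y ih => ih.bind fun i => approx d l (Nat.pair p.unpair.1 (Nat.pair y i))) p.unpair.2
  | rfind c, l, a =>
      let x := (searchStep fun m => approx c l (Nat.pair a m))^[l.length] 0
      (approx c l (Nat.pair a x)).bind fun v => if v = 0 then some x else none

theorem primrec_approx (c : OracleCode) : Primrec₂ (approx c) := by
  have hu1 : Primrec fun p : List ℕ × ℕ => p.2.unpair.1 :=
    Primrec.fst.comp (Primrec.unpair.comp Primrec.snd)
  have hu2 : Primrec fun p : List ℕ × ℕ => p.2.unpair.2 :=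
    Primrec.snd.comp (Primrec.unpair.comp Primrec.snd)
  induction c with
  | zero => exact Primrec.const (some 0)
  | succ => exact Primrec.option_some.comp (Primrec.succ.comp Primrec.snd)
  | left => exact Primrec.option_some.comp hu1
  | right => exact Primrec.option_some.comp hu2
  | oracle =>
    exact Primrec.list_getElem?.comp (Primrec.list_reverse.comp Primrec.fst) Primrec.snd
  | pair c d ihc ihd =>
    refine Primrec.option_bind ihc (Primrec.option_bind
      (ihd.comp (Primrec.fst.comp Primrec.fst) (Primrec.snd.comp Primrec.fst)) ?_)
    exact Primrec.option_some.comp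
      (Primrec₂.natPair.comp (Primrec.snd.comp Primrec.fst) Primrec.snd)
  | comp c d ihc ihd =>
    exact Primrec.option_bind ihd (ihc.comp (Primrec.fst.comp Primrec.fst) Primrec.snd)
  | prec c d ihc ihd =>
    refine Primrec.nat_rec' (f := fun p : List ℕ × ℕ => p.2.unpair.2)
      (g := fun p : List ℕ × ℕ => approx c p.1 p.2.unpair.1)
      (h := fun (p : List ℕ × ℕ) (q : ℕ × Option ℕ) => q.2.bind fun i =>
        approx d p.1 (Nat.pair p.2.unpair.1 (Nat.pair q.1 i)))
      hu2 (ihc.comp Primrec.fst hu1) ?_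
    refine Primrec.option_bind (Primrec.snd.comp Primrec.snd) ?_
    refine ihd.comp (Primrec.fst.comp (Primrec.fst.comp Primrec.fst)) ?_
    refine Primrec₂.natPair.comp (hu1.comp (Primrec.fst.comp Primrec.fst)) ?_
    exact Primrec₂.natPair.comp
      (Primrec.fst.comp (Primrec.snd.comp Primrec.fst)) Primrec.snd
  | rfind c ihc =>
    have hr : Primrec₂ fun (p : List ℕ × ℕ) (m : ℕ) => approx c p.1 (Nat.pair p.2 m) :=
      ihc.comp (Primrec.fst.comp Primrec.fst)
        (Primrec₂.natPair.comp (Primrec.snd.comp Primrec.fst) Primrec.snd)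
    have hs : Primrec₂ fun (p : List ℕ × ℕ) (m : ℕ) =>
        searchStep (fun m => approx c p.1 (Nat.pair p.2 m)) m := by
      refine Primrec.ite (Primrec.eq.comp (Primrec.option_getD.comp hr (Primrec.const 0))
        (Primrec.const 0)) Primrec.snd (Primrec.succ.comp Primrec.snd)
    have hx : Primrec fun p : List ℕ × ℕ =>
        (searchStep fun m => approx c p.1 (Nat.pair p.2 m))^[p.1.length] 0 :=
      Primrec.nat_iterate (Primrec.list_length.comp Primrec.fst) (Primrec.const 0) hs
    refine Primrec.option_bind (hr.comp Primrec.id hx) ?_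
    exact Primrec.ite (Primrec.eq.comp Primrec.snd (Primrec.const 0))
      (Primrec.option_some.comp (hx.comp Primrec.fst)) (Primrec.const none)

/-- The first `s` values of `g`, last value first. -/
def initSeg (g : ℕ → ℕ) : ℕ → List ℕ
  | 0 => []
  | s + 1 => g s :: initSeg g s

theorem initSeg_reverse (g : ℕ → ℕ) (s : ℕ) :
    (initSeg g s).reverse = (List.range s).map g := by
  induction s with
  | zero => rfl
  | succ s ih => simp [initSeg, ih, List.range_succ]

theorem initSeg_length (g : ℕ → ℕ) (s : ℕ) : (initSeg g s).length = s := by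
  induction s with
  | zero => rfl
  | succ s ih => simp [initSeg, ih]

theorem searchStep_iterate_pos (r : ℕ → Option ℕ) (k m : ℕ)
    (hm : m < (searchStep r)^[k] 0) : ∃ v, r m = some (v + 1) := by
  induction k with
  | zero => simp at hm
  | succ k ih =>
    rw [Function.iterate_succ_apply'] at hm
    set x := (searchStep r)^[k] 0 with hx
    unfold searchStep at hm
    split_ifs at hm with h
    · exact ih hm
    · rcases Nat.lt_succ_iff_lt_or_eq.1 hm with h' | rfl
      · exact ih h'
      · cases hr : r x with
        | none => simp [hr] at h
        | some v => exact ⟨v - 1, by simp [hr] at h; congr 1; omega⟩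

theorem searchStep_iterate_eq (r : ℕ → Option ℕ) (M : ℕ) (h0 : r M = some 0)
    (hpos : ∀ m < M, ∃ v, r m = some (v + 1)) (k : ℕ) : (searchStep r)^[k] 0 = min k M := by
  induction k with
  | zero => simp
  | succ k ih =>
    rw [Function.iterate_succ_apply', ih]
    rcases lt_or_ge k M with h | h
    · obtain ⟨v, hv⟩ := hpos k h
      rw [min_eq_left h.le, min_eq_left (Nat.succ_le_of_lt h)]
      simp [searchStep, hv]
    · rw [min_eq_right h, min_eq_right (h.trans (Nat.le_succ k))]
      simp [searchStep, h0]

theorem approx_sound (g : ℕ → ℕ) (s : ℕ) (c : OracleCode) :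
    ∀ n y, approx c (initSeg g s) n = some y → y ∈ eval g c n := by
  induction c with
  | zero => intro n y h; simpa [approx, eval, eq_comm] using h
  | succ => intro n y h; simpa [approx, eval, eq_comm] using h
  | left => intro n y h; simpa [approx, eval, eq_comm] using h
  | right => intro n y h; simpa [approx, eval, eq_comm] using h
  | oracle =>
    intro n y h
    simp only [approx, initSeg_reverse] at h
    obtain ⟨a, ha, rfl⟩ : ∃ a, (List.range s)[n]? = some a ∧ g a = y := by simpa using h
    obtain ⟨_, rfl⟩ := List.getElem?_eq_some_iff.1 ha
    simp [eval]
  | pair c d ihc ihd =>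
    intro n y h
    simp only [approx, Option.bind_eq_some_iff] at h
    obtain ⟨a, ha, b, hb, h⟩ := h
    simp only [eval, Part.mem_bind_iff]
    exact ⟨a, ihc _ _ ha, b, ihd _ _ hb, by simpa [eq_comm] using h⟩
  | comp c d ihc ihd =>
    intro n y h
    simp only [approx, Option.bind_eq_some_iff] at h
    obtain ⟨a, ha, h⟩ := h
    simp only [eval, Part.mem_bind_iff]
    exact ⟨a, ihd _ _ ha, ihc _ _ h⟩
  | prec c d ihc ihd =>
    intro n
    simp only [approx, eval]
    induction n.unpair.2 with
    | zero => intro y h; exact ihc _ _ h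
    | succ m ih =>
      intro y h
      simp only [Option.bind_eq_some_iff] at h
      obtain ⟨a, ha, h⟩ := h
      simp only [Part.mem_bind_iff]
      exact ⟨a, ih _ ha, ihd _ _ h⟩
  | rfind c ihc =>
    intro n y h
    simp only [approx, Option.bind_eq_some_iff] at h
    obtain ⟨v, hv, h⟩ := h
    split_ifs at h with hv0
    subst hv0
    obtain rfl := Option.some.inj h
    refine mem_eval_rfind.2 ⟨ihc _ _ hv, fun m hm => ?_⟩
    obtain ⟨v, hv⟩ := searchStep_iterate_pos _ _ _ hm
    exact ⟨v, ihc _ _ hv⟩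

theorem approx_complete (g : ℕ → ℕ) (c : OracleCode) :
    ∀ n y, y ∈ eval g c n → ∀ᶠ s in Filter.atTop, approx c (initSeg g s) n = some y := by
  induction c with
  | zero => intro n y h; exact Filter.Eventually.of_forall fun s => by simpa [approx, eval, eq_comm] using h
  | succ => intro n y h; exact Filter.Eventually.of_forall fun s => by simpa [approx, eval, eq_comm] using h
  | left => intro n y h; exact Filter.Eventually.of_forall fun s => by simpa [approx, eval, eq_comm] using h
  | right => intro n y h; exact Filter.Eventually.of_forall fun s => by simpa [approx, eval, eq_comm] using h
  | oracle =>
    intro n y h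
    filter_upwards [Filter.eventually_gt_atTop n] with s hs
    have : y = g n := by simpa [eval] using h
    simp [approx, initSeg_reverse, this, hs]
  | pair c d ihc ihd =>
    intro n y h
    simp only [eval, Part.mem_bind_iff] at h
    obtain ⟨a, ha, b, hb, h⟩ := h
    filter_upwards [ihc _ _ ha, ihd _ _ hb] with s h1 h2
    have : y = Nat.pair a b := by simpa using h
    simp [approx, h1, h2, this]
  | comp c d ihc ihd =>
    intro n y h
    simp only [eval, Part.mem_bind_iff] at h
    obtain ⟨a, ha, h⟩ := h
    filter_upwards [ihd _ _ ha, ihc _ _ h] with s h1 h2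
    simp [approx, h1, h2]
  | prec c d ihc ihd =>
    intro n
    simp only [approx, eval]
    induction n.unpair.2 with
    | zero => intro y h; exact ihc _ _ h
    | succ m ih =>
      intro y h
      simp only [Part.mem_bind_iff] at h
      obtain ⟨a, ha, h⟩ := h
      filter_upwards [ih _ ha, ihd _ _ h] with s h1 h2
      simp only [h1, Option.bind_some, h2]
  | rfind c ihc =>
    intro n y h
    obtain ⟨hv, hlt⟩ := mem_eval_rfind.1 h
    have hall : ∀ m : ℕ, ∀ᶠ s in Filter.atTop,
        m < y → ∃ v, approx c (initSeg g s) (Nat.pair n m) = some (v + 1) := by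
      intro m
      by_cases hm : m < y
      · obtain ⟨v, hv⟩ := hlt m hm
        filter_upwards [ihc _ _ hv] with s hs _
        exact ⟨v, hs⟩
      · exact Filter.Eventually.of_forall fun s h => absurd h hm
    have hall' := (Filter.eventually_all_finset (Finset.range y)).2 fun m _ => hall m
    filter_upwards [ihc _ _ hv, hall', Filter.eventually_ge_atTop y] with s h1 h2 h3
    have hx := searchStep_iterate_eq (fun m => approx c (initSeg g s) (Nat.pair n m)) y h1
      (fun m hm => h2 m (Finset.mem_range.2 hm) hm) (initSeg g s).length
    rw [initSeg_length, min_eq_right h3] at hx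
    simp [approx, initSeg_length, hx, h1]

/-- Uniformly in the oracle `g`, the code of the string `g(0), …, g(s-1)` is computable from `s`. -/
theorem exists_initSeg :
    ∃ c : OracleCode, ∀ g a s,
      eval g c (Nat.pair a s) = Part.some (Encodable.encode (initSeg g s)) := by
  refine ⟨prec zero (comp succ (pair (comp oracle (comp left right)) (comp right right))), ?_⟩
  intro g a s
  simp only [eval, Nat.unpair_pair]
  induction s with
  | zero => simp [initSeg]
  | succ s ih =>
    simp only [] at ih ⊢
    rw [ih]
    simp [initSeg, Encodable.encode_list_cons]

/-- The universal oracle program. -/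
theorem exists_universal :
    ∃ U : OracleCode, ∀ c : OracleCode, ∃ e : ℕ, ∀ g n, eval g U (Nat.pair e n) = eval g c n := by
  obtain ⟨S, hS⟩ := exists_initSeg
  have huniv : Nat.Partrec fun p => Nat.Partrec.Code.eval
      ((Encodable.decode (α := Nat.Partrec.Code) p.unpair.1).getD Nat.Partrec.Code.zero)
      p.unpair.2 := by
    refine Partrec.nat_iff.1 ?_
    refine Nat.Partrec.Code.eval_part.comp ?_ (Computable.snd.comp Computable.unpair)
    exact Computable.option_getD
      (Computable.decode.comp (Computable.fst.comp Computable.unpair)) (Computable.const _)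
  obtain ⟨V, hV⟩ := exists_of_partrec huniv
  obtain ⟨T, hT⟩ := exists_of_computable (f := fun z => 1 - z)
    (Primrec.nat_sub.comp (Primrec.const 1) Primrec.id).to_comp
  obtain ⟨P, hP⟩ := exists_of_computable (f := Nat.pred) Primrec.pred.to_comp
  obtain ⟨I, hI⟩ := exists_of_computable (f := fun z => z) Computable.id
  -- `Z` maps `((e, n), s)` to the value of the approximation with index `e` on `(g ↾ s, n)`
  let Z : OracleCode := comp V (pair (comp left left) (pair S (comp right left)))
  refine ⟨comp (comp P Z) (pair I (rfind (comp T Z))), fun c => ?_⟩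
  have hA : Computable fun x : ℕ => Encodable.encode
      (approx c ((Encodable.decode (α := List ℕ) x.unpair.1).getD []) x.unpair.2) := by
    refine Computable.encode.comp ((primrec_approx c).to_comp.comp ?_
      (Computable.snd.comp Computable.unpair))
    exact Computable.option_getD
      (Computable.decode.comp (Computable.fst.comp Computable.unpair)) (Computable.const _)
  obtain ⟨k, hk⟩ := Nat.Partrec.Code.exists_code.1 (Partrec.nat_iff.1 hA)
  refine ⟨Encodable.encode k, fun g n => ?_⟩
  have hZ : ∀ s, eval g Z (Nat.pair (Nat.pair (Encodable.encode k) n) s) =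
      Part.some (Encodable.encode (approx c (initSeg g s) n)) := by
    intro s
    simp [Z, eval, hS, hV, hk]
  have hR : ∀ y, y ∈ eval g (comp (comp P Z) (pair I (rfind (comp T Z))))
      (Nat.pair (Encodable.encode k) n) ↔
      ∃ s, s ∈ eval g (rfind (comp T Z)) (Nat.pair (Encodable.encode k) n) ∧
        y = Nat.pred (Encodable.encode (approx c (initSeg g s) n)) := by
    intro y
    rw [eval, eval]
    simp only [hI, Part.bind_some, Part.mem_bind_iff, Part.mem_some_iff]
    constructor
    · rintro ⟨_, ⟨s, hs, rfl⟩, h⟩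
      refine ⟨s, hs, ?_⟩
      rw [eval] at h
      simpa [hZ, hP] using h
    · rintro ⟨s, hs, rfl⟩
      refine ⟨_, ⟨s, hs, rfl⟩, ?_⟩
      rw [eval]
      simp [hZ, hP]
  have hF : ∀ s, s ∈ eval g (rfind (comp T Z)) (Nat.pair (Encodable.encode k) n) →
      ∃ y, approx c (initSeg g s) n = some y := by
    intro s hs
    have h1 := (mem_eval_rfind.1 hs).1
    simp only [eval, hZ, Part.bind_some, hT, Part.mem_some_iff] at h1
    cases h : approx c (initSeg g s) n with
    | none => simp [h] at h1
    | some y => exact ⟨y, rfl⟩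
  ext y
  rw [hR]
  constructor
  · rintro ⟨s, hs, rfl⟩
    obtain ⟨y, hy⟩ := hF s hs
    rw [hy]
    simpa using approx_sound g s c n y hy
  · intro hy
    obtain ⟨s, hs⟩ := (approx_complete g c n y hy).exists
    have hdom : (eval g (rfind (comp T Z)) (Nat.pair (Encodable.encode k) n)).Dom := by
      rw [eval]
      refine Nat.rfind_dom.2 ⟨s, ?_, fun {m} _ => ?_⟩
      · rw [eval]
        simp [hZ, hT, hs]
      · rw [eval]
        simp [hZ, hT]
    obtain ⟨s', hs'⟩ := Part.dom_iff_mem.1 hdom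
    refine ⟨s', hs', ?_⟩
    obtain ⟨y', hy'⟩ := hF s' hs'
    rw [hy']
    simpa using Part.mem_unique hy (approx_sound g s' c n y' hy')

/-- The function `n⌢f` with first value `n` followed by the values of `f`. -/
def consFun (n : ℕ) (f : ℕ → ℕ) : ℕ → ℕ
  | 0 => n
  | k + 1 => f k

/-- The function that codes the pair of functions `f, g`. -/
def pairFun (f g : ℕ → ℕ) : ℕ → ℕ := fun n => Nat.pair (f n) (g n)

/-- The tail of the oracle is computable from the oracle. -/
theorem exists_tail : ∃ c : OracleCode, ∀ n f k, eval (consFun n f) c k = Part.some (f k) :=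
  ⟨comp oracle succ, fun n f k => by simp [eval, consFun]⟩

theorem exists_head : ∃ c : OracleCode, ∀ g k, eval g c k = Part.some (g 0) :=
  ⟨comp oracle zero, fun g k => by simp [eval]⟩

theorem exists_cons (a d : OracleCode) : ∃ c : OracleCode, ∀ g n f,
    (∀ k, eval g a k = Part.some n) → (∀ k, eval g d k = Part.some (f k)) →
    ∀ k, eval g c k = Part.some (consFun n f k) := by
  obtain ⟨I, hI⟩ := exists_of_computable (f := fun z => z) Computable.id
  refine ⟨comp (prec a (comp d (comp left right))) (pair I I), fun g n f ha hd k => ?_⟩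
  simp only [eval, hI, Part.bind_some, Nat.unpair_pair, ha]
  induction k with
  | zero => simp [consFun]
  | succ k ih =>
    simp only [] at ih ⊢
    rw [ih]
    simp [consFun, hd]

/-- A fixed universal oracle program. -/
noncomputable def universal : OracleCode := exists_universal.choose

theorem universal_spec (c : OracleCode) :
    ∃ e : ℕ, ∀ g n, eval g universal (Nat.pair e n) = eval g c n :=
  exists_universal.choose_spec c

/-- Case distinction on the first value of the oracle. -/
theorem exists_cases (c d : OracleCode) : ∃ u : OracleCode, ∀ f k,
    eval (consFun 0 f) u k = eval f c k ∧ eval (consFun 1 f) u k = eval f d k := by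
  obtain ⟨e₀, h₀⟩ := universal_spec c
  obtain ⟨e₁, h₁⟩ := universal_spec d
  obtain ⟨T, hT⟩ := exists_tail
  obtain ⟨H, hH⟩ := exists_head
  obtain ⟨I, hI⟩ := exists_of_computable (f := fun z => z) Computable.id
  obtain ⟨E, hE⟩ := exists_of_computable (f := fun z => if z = 0 then e₀ else e₁)
    (Primrec.ite (Primrec.eq.comp Primrec.id (Primrec.const 0))
      (Primrec.const e₀) (Primrec.const e₁)).to_comp
  refine ⟨comp (subst T universal) (pair (comp E H) I), fun f k => ⟨?_, ?_⟩⟩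
  · simp [eval, hH, hE, hI, consFun, eval_subst (hT 0 f), h₀]
  · simp [eval, hH, hE, hI, consFun, eval_subst (hT 1 f), h₁]

end OracleCode

/-! ## The Medvedev lattice -/

/-- A mass problem is a set of functions from `ω` to `ω`. -/
def MassProblem : Type := Set (ℕ → ℕ)

namespace MassProblem

open OracleCode

/-- The functions in a mass problem. -/
def sols (A : MassProblem) : Set (ℕ → ℕ) := A

/-- Medvedev reducibility: `A ≤ B` if one oracle program computes, with any `g ∈ B` as its oracle,
some total function `f ∈ A`. -/
def Reducible (A B : MassProblem) : Prop :=
  ∃ c : OracleCode, ∀ g ∈ B.sols, ∃ f ∈ A.sols, ∀ n, eval g c n = Part.some (f n)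

theorem Reducible.refl (A : MassProblem) : Reducible A A :=
  ⟨oracle, fun g hg => ⟨g, hg, fun _ => rfl⟩⟩

theorem Reducible.of_subset {A B : MassProblem} (h : B.sols ⊆ A.sols) : Reducible A B :=
  ⟨oracle, fun g hg => ⟨g, h hg, fun _ => rfl⟩⟩

theorem Reducible.trans {A B C : MassProblem} (h₁ : Reducible A B) (h₂ : Reducible B C) :
    Reducible A C := by
  obtain ⟨c, hc⟩ := h₁
  obtain ⟨d, hd⟩ := h₂
  refine ⟨subst d c, fun g hg => ?_⟩
  obtain ⟨f, hf, hfe⟩ := hd g hg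
  obtain ⟨f', hf', hfe'⟩ := hc f hf
  exact ⟨f', hf', fun n => by rw [eval_subst hfe, hfe']⟩

instance : Preorder MassProblem where
  le := Reducible
  le_refl := Reducible.refl
  le_trans _ _ _ := Reducible.trans

/-- The join `A + B`: the (codes of) pairs of a function in `A` and a function in `B`. -/
def join (A B : MassProblem) : MassProblem :=
  {h | ∃ f ∈ A.sols, ∃ g ∈ B.sols, h = pairFun f g}

/-- The meet `A × B = 0⌢A ∪ 1⌢B`. -/
def meet (A B : MassProblem) : MassProblem :=
  {h | (∃ f ∈ A.sols, h = consFun 0 f) ∨ (∃ g ∈ B.sols, h = consFun 1 g)}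

/-- The implication `A → B`: all `n⌢f` such that for every `g ∈ A` the `n`-th oracle program
computes with the oracle `(g, f)` a function in `B`. -/
def arrow (A B : MassProblem) : MassProblem :=
  {h | ∃ n f, h = consFun n f ∧
    ∀ g ∈ A.sols, ∃ f' ∈ B.sols, ∀ k, eval (pairFun g f) universal (Nat.pair n k) = Part.some (f' k)}

theorem le_join_left (A B : MassProblem) : A ≤ join A B := by
  refine ⟨comp left oracle, ?_⟩
  rintro _ ⟨f, hf, g, hg, rfl⟩
  exact ⟨f, hf, fun n => by simp [eval, pairFun]⟩

theorem le_join_right (A B : MassProblem) : B ≤ join A B := by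
  refine ⟨comp right oracle, ?_⟩
  rintro _ ⟨f, hf, g, hg, rfl⟩
  exact ⟨g, hg, fun n => by simp [eval, pairFun]⟩

theorem join_le {A B C : MassProblem} (h₁ : A ≤ C) (h₂ : B ≤ C) : join A B ≤ C := by
  obtain ⟨c, hc⟩ := h₁
  obtain ⟨d, hd⟩ := h₂
  refine ⟨pair c d, fun h hh => ?_⟩
  obtain ⟨f, hf, hfe⟩ := hc h hh
  obtain ⟨g, hg, hge⟩ := hd h hh
  exact ⟨pairFun f g, ⟨f, hf, g, hg, rfl⟩, fun n => by simp [eval, hfe, hge, pairFun]⟩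

theorem meet_le_of_cons {A C : MassProblem} (n : ℕ)
    (h : ∀ f ∈ C.sols, consFun n f ∈ A.sols) : A ≤ C := by
  obtain ⟨a, ha⟩ := exists_of_computable (f := fun _ => n) (Computable.const n)
  obtain ⟨c, hc⟩ := exists_cons a oracle
  exact ⟨c, fun f hf => ⟨_, h f hf, hc f n f (ha f) fun _ => rfl⟩⟩

theorem meet_le_left (A B : MassProblem) : meet A B ≤ A :=
  meet_le_of_cons 0 fun f hf => Or.inl ⟨f, hf, rfl⟩

theorem meet_le_right (A B : MassProblem) : meet A B ≤ B :=
  meet_le_of_cons 1 fun f hf => Or.inr ⟨f, hf, rfl⟩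

theorem le_meet {A B C : MassProblem} (h₁ : C ≤ A) (h₂ : C ≤ B) : C ≤ meet A B := by
  obtain ⟨c, hc⟩ := h₁
  obtain ⟨d, hd⟩ := h₂
  obtain ⟨u, hu⟩ := exists_cases c d
  refine ⟨u, ?_⟩
  rintro _ (⟨f, hf, rfl⟩ | ⟨f, hf, rfl⟩)
  · obtain ⟨f', hf', h⟩ := hc f hf
    exact ⟨f', hf', fun n => by rw [(hu f n).1, h]⟩
  · obtain ⟨f', hf', h⟩ := hd f hf
    exact ⟨f', hf', fun n => by rw [(hu f n).2, h]⟩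

theorem arrow_le_iff {A B C : MassProblem} : arrow A B ≤ C ↔ B ≤ join A C := by
  constructor
  · rintro ⟨c, hc⟩
    obtain ⟨I, hI⟩ := exists_of_computable (f := fun z => z) Computable.id
    let r : OracleCode := subst (comp right oracle) c
    refine ⟨comp (subst (pair (comp left oracle) (comp r succ)) universal) (pair (comp r zero) I),
      ?_⟩
    rintro _ ⟨g, hg, h, hh, rfl⟩
    obtain ⟨_, ⟨n, f, rfl, hf⟩, hcf⟩ := hc h hh
    obtain ⟨f', hf', hf'e⟩ := hf g hg
    have hr : ∀ k, eval (pairFun g h) r k = Part.some (consFun n f k) := fun k => by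
      rw [eval_subst (f := h) (fun n => by simp [eval, pairFun]), hcf]
    refine ⟨f', hf', fun k => ?_⟩
    have hs : ∀ k, eval (pairFun g h) (pair (comp left oracle) (comp r succ)) k =
        Part.some (pairFun g f k) := fun k => by
      simp [eval, hr, pairFun, consFun]
    simp [eval, hr, hI, eval_subst hs, consFun, hf'e]
  · rintro ⟨c, hc⟩
    obtain ⟨e, he⟩ := universal_spec c
    refine meet_le_of_cons e fun f hf => ⟨e, f, rfl, fun g hg => ?_⟩
    obtain ⟨f', hf', h⟩ := hc _ ⟨g, hg, f, hf, rfl⟩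
    exact ⟨f', hf', fun k => by rw [he, h]⟩

/-- The least mass problem: all functions. -/
def bot : MassProblem := Set.univ

/-- The greatest mass problem: no functions. -/
def top : MassProblem := (∅ : Set (ℕ → ℕ))

theorem bot_le (A : MassProblem) : bot ≤ A := Reducible.of_subset (Set.subset_univ _)

theorem le_top (A : MassProblem) : A ≤ top := Reducible.of_subset (Set.empty_subset _)

/-- The mass problem `B_f` of all functions that are not Turing reducible to `f`. -/
def notReducibleTo (f : ℕ → ℕ) : MassProblem :=
  {g : ℕ → ℕ | ¬ TuringReducible (g : ℕ →. ℕ) (f : ℕ →. ℕ)}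

end MassProblem

/-- The Medvedev degrees: mass problems up to Medvedev equivalence, ordered by Medvedev
reducibility. -/
def Medvedev : Type := Antisymmetrization MassProblem (· ≤ ·)

namespace Medvedev

open MassProblem

instance : PartialOrder Medvedev :=
  inferInstanceAs (PartialOrder (Antisymmetrization MassProblem (· ≤ ·)))

/-- The Medvedev degree of a mass problem. -/
def deg (A : MassProblem) : Medvedev := toAntisymmetrization (· ≤ ·) A

theorem deg_le_deg {A B : MassProblem} : deg A ≤ deg B ↔ A ≤ B := Iff.rfl

theorem ind {P : Medvedev → Prop} (h : ∀ A, P (deg A)) (a : Medvedev) : P a :=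
  Quotient.ind h a

/-- The Medvedev lattice as a Brouwer algebra. -/
instance : CoheytingAlgebra Medvedev where
  sup := Quotient.map₂ join fun _ _ h₁ _ _ h₂ =>
    ⟨join_le (h₁.1.trans (le_join_left _ _)) (h₂.1.trans (le_join_right _ _)),
      join_le (h₁.2.trans (le_join_left _ _)) (h₂.2.trans (le_join_right _ _))⟩
  inf := Quotient.map₂ meet fun _ _ h₁ _ _ h₂ =>
    ⟨le_meet ((meet_le_left _ _).trans h₁.1) ((meet_le_right _ _).trans h₂.1),
      le_meet ((meet_le_left _ _).trans h₁.2) ((meet_le_right _ _).trans h₂.2)⟩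
  sdiff := Quotient.map₂ (fun B A => arrow A B) fun _ _ h₁ _ _ h₂ =>
    ⟨arrow_le_iff.2 (h₁.1.trans ((arrow_le_iff.1 le_rfl).trans
        (join_le (h₂.2.trans (le_join_left _ _)) (le_join_right _ _)))),
      arrow_le_iff.2 (h₁.2.trans ((arrow_le_iff.1 le_rfl).trans
        (join_le (h₂.1.trans (le_join_left _ _)) (le_join_right _ _))))⟩
  hnot := Quotient.map (fun A => arrow A MassProblem.top) fun _ _ h =>
    ⟨arrow_le_iff.2 ((arrow_le_iff.1 le_rfl).trans
        (join_le (h.2.trans (le_join_left _ _)) (le_join_right _ _))),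
      arrow_le_iff.2 ((arrow_le_iff.1 le_rfl).trans
        (join_le (h.1.trans (le_join_left _ _)) (le_join_right _ _)))⟩
  bot := deg MassProblem.bot
  top := deg MassProblem.top
  le_sup_left := ind fun A => ind fun B => le_join_left A B
  le_sup_right := ind fun A => ind fun B => le_join_right A B
  sup_le := ind fun _ => ind fun _ => ind fun _ h₁ h₂ =>
    deg_le_deg.2 (join_le (deg_le_deg.1 h₁) (deg_le_deg.1 h₂))
  inf_le_left := ind fun A => ind fun B => meet_le_left A B
  inf_le_right := ind fun A => ind fun B => meet_le_right A B
  le_inf := ind fun _ => ind fun _ => ind fun _ h₁ h₂ =>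
    deg_le_deg.2 (le_meet (deg_le_deg.1 h₁) (deg_le_deg.1 h₂))
  bot_le := ind fun A => MassProblem.bot_le A
  le_top := ind fun A => MassProblem.le_top A
  sdiff_le_iff := ind fun _ => ind fun _ => ind fun _ => arrow_le_iff
  top_sdiff := ind fun _ => rfl

/-- The Medvedev degree `𝐁_n = 𝐁_{f₁} + … + 𝐁_{f_n}`, where `𝐁_f` is the degree of
`{g : g ≰_T f}`. The empty join is the least degree. -/
noncomputable def degB (f : ℕ → ℕ → ℕ) (n : ℕ) : Medvedev :=
  (Finset.Icc 1 n).sup fun i => deg (notReducibleTo (f i))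

end Medvedev

/-!
The degree `𝐁_f` lies below the degree of a mass problem `A` exactly when no member of `A` is
Turing reducible to `f`. Since the functions reducible to `f` are closed under pairing, `𝐁_f` is
join-prime; and `𝐁_f ≤ 𝐁_g` forces `f ≤_T g`. Hence `𝔐/𝐁_n` is a Brouwer algebra in which the top
is the join of an antichain of `n` join-prime elements `b i`, while the bottom is meet-prime,
because a mass problem has degree `0` exactly when it has a computable member.

In such an algebra `¬ a` is the join of those `b i` that are not below `a`, so the negated elements
are the joins `b_T` of the sets `T` of indices, and `b_T ≤ b_U` if and only if `T ⊆ U`. As the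
bottom is meet-prime, a disjunction is valued `⊥` only if one of its disjuncts is.

* A refutation of `φ_k`, `k > 1`, is thus an antichain of `k` subsets of the index set whose union
  is not the whole of it. By Sperner's theorem one exists for `k = C(n, ⌊n/2⌋)` if there are
  more than `n` indices, and none exists if there are `n`.
* If `¬ p₀, …, ¬ p_n` are given by `n + 1` sets `T₀, …, T_n` of indices, the premise of `σ_n` is
  given by the set `E` of indices missing from at least two of them. With only `n` indices, some
  `T i` contains every index outside `E`, by the pigeonhole principle, and the corresponding
  disjunct lies below the premise. With more than `n` indices, the complements of `n + 1` distinct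
  singletons refute `σ_n`.
-/

/-! ### Values of finite disjunctions and conjunctions -/

namespace PropFormula

variable {L : Type*} [CoheytingAlgebra L] (v : ℕ → L)

theorem le_eval_bigOr_iff {c : L} (l : List PropFormula) :
    c ≤ (bigOr l).eval v ↔ ∀ a ∈ l, c ≤ a.eval v := by
  induction l using bigOr.induct with
  | case1 => simp [bigOr, eval]
  | case2 a => simp [bigOr]
  | case3 a b l ih =>
    rw [bigOr, eval, le_inf_iff, ih]
    simp

theorem eval_bigAnd_le_iff {c : L} (l : List PropFormula) :
    (bigAnd l).eval v ≤ c ↔ ∀ a ∈ l, a.eval v ≤ c := by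
  induction l using bigAnd.induct with
  | case1 => simp [bigAnd, eval]
  | case2 a => simp [bigAnd]
  | case3 a b l ih =>
    rw [bigAnd, eval, sup_le_iff, ih]
    simp

theorem exists_eval_eq_bot_of_bigOr (hL : InfPrime (⊥ : L)) (l : List PropFormula)
    (h : (bigOr l).eval v = ⊥) : ∃ a ∈ l, a.eval v = ⊥ := by
  induction l using bigOr.induct with
  | case1 =>
    refine absurd (fun x _ => ?_) hL.1
    simp only [bigOr, eval, sdiff_self, sdiff_bot] at h
    exact h ▸ le_top
  | case2 a => exact ⟨a, by simp, h⟩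
  | case3 a b l ih =>
    rcases hL.2 (le_of_eq h) with h | h
    · exact ⟨a, by simp, le_bot_iff.1 h⟩
    · obtain ⟨c, hc, hc'⟩ := ih (le_bot_iff.1 h)
      exact ⟨c, List.mem_cons_of_mem _ hc, hc'⟩

theorem eval_bigOr_eq_bot {l : List PropFormula} {a : PropFormula} (ha : a ∈ l)
    (h : a.eval v = ⊥) : (bigOr l).eval v = ⊥ :=
  le_bot_iff.1 (h ▸ (le_eval_bigOr_iff v l).1 le_rfl a ha)

end PropFormula

/-! ### Brouwer algebras whose top is a finite join of primes -/

/-- The top of `L` is the join of the family `b`, which is an antichain of join-prime elements. -/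
structure IsPrimeDecomposition {L ι : Type*} [CoheytingAlgebra L] [Fintype ι] (b : ι → L) :
    Prop where
  prime : ∀ i, SupPrime (b i)
  eq_of_le : ∀ i j, b i ≤ b j → i = j
  sup_eq_top : Finset.univ.sup b = ⊤

namespace IsPrimeDecomposition

open PropFormula

variable {L ι : Type*} [CoheytingAlgebra L] [Fintype ι] {b : ι → L}

theorem le_sup_iff (hb : IsPrimeDecomposition b) {i : ι} {T : Finset ι} :
    b i ≤ T.sup b ↔ i ∈ T := by
  refine ⟨fun h => ?_, fun h => Finset.le_sup h⟩
  obtain ⟨j, hj, hij⟩ := (hb.prime i).le_finset_sup.1 h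
  exact hb.eq_of_le i j hij ▸ hj

theorem sup_le_sup_iff (hb : IsPrimeDecomposition b) {T U : Finset ι} :
    T.sup b ≤ U.sup b ↔ T ⊆ U :=
  ⟨fun h _ hi => hb.le_sup_iff.1 ((Finset.le_sup hi).trans h), Finset.sup_mono⟩

theorem sup_eq_bot_iff (hb : IsPrimeDecomposition b) {T : Finset ι} :
    T.sup b = ⊥ ↔ T = ∅ := by
  rw [← le_bot_iff, ← Finset.sup_empty (f := b), hb.sup_le_sup_iff, Finset.subset_empty]

theorem top_le_iff (hb : IsPrimeDecomposition b) {a : L} : ⊤ ≤ a ↔ ∀ i, b i ≤ a := by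
  simp [← hb.sup_eq_top]

open Classical in
/-- The set of indices `T` such that `¬ a` is the join of the `b i` with `i ∈ T`. -/
noncomputable def negSupport (b : ι → L) (a : L) : Finset ι :=
  Finset.univ.filter fun i => ¬ b i ≤ a

theorem mem_negSupport {i : ι} {a : L} : i ∈ negSupport b a ↔ ¬ b i ≤ a := by
  simp [negSupport]

theorem top_sdiff_eq (hb : IsPrimeDecomposition b) (a : L) :
    ⊤ \ a = (negSupport b a).sup b := by
  refine le_antisymm (sdiff_le_iff.2 (hb.top_le_iff.2 fun i => ?_)) (Finset.sup_le fun i hi => ?_)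
  · by_cases h : b i ≤ a
    · exact h.trans le_sup_left
    · exact (Finset.le_sup (mem_negSupport.2 h)).trans le_sup_right
  · exact ((hb.prime i).2 (le_top.trans (sdiff_le_iff.1 le_rfl))).resolve_left (mem_negSupport.1 hi)

theorem le_top_sdiff_iff (hb : IsPrimeDecomposition b) {i : ι} {a : L} :
    b i ≤ ⊤ \ a ↔ ¬ b i ≤ a := by
  rw [hb.top_sdiff_eq, hb.le_sup_iff, mem_negSupport]

theorem top_sdiff_le_iff (hb : IsPrimeDecomposition b) {a c : L} :
    ⊤ \ a ≤ c ↔ ∀ i, b i ≤ a ∨ b i ≤ c := by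
  rw [sdiff_le_iff, hb.top_le_iff]
  exact forall_congr' fun i => (hb.prime i).le_sup

/-- Every join of the family `b` is a negation. -/
theorem top_sdiff_sup_compl [DecidableEq ι] (hb : IsPrimeDecomposition b) (T : Finset ι) :
    ⊤ \ Tᶜ.sup b = T.sup b := by
  rw [hb.top_sdiff_eq]
  congr 1
  ext i
  simp [mem_negSupport, hb.le_sup_iff]

/-! ### The formulas `φ_k` -/

theorem phi_one_mem (hb : IsPrimeDecomposition b) (hι : Fintype.card ι = 1) :
    phi 1 ∈ brouwerTheory L := by
  intro v
  obtain ⟨x, hx⟩ := Fintype.card_eq_one_iff.1 hι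
  simp only [phi, if_pos, eval, hb.top_sdiff_eq (v 1)]
  by_cases h : b x ≤ v 1
  · rw [hb.sup_eq_bot_iff.2, bot_inf_eq]
    exact Finset.eq_empty_of_forall_notMem fun i => by simp [mem_negSupport, hx i, h]
  · have : (negSupport b (v 1)).sup b = ⊤ := _root_.top_le_iff.1 <| hb.top_le_iff.2 fun i =>
      hb.le_sup_iff.2 (mem_negSupport.2 (by rwa [hx i]))
    rw [this, sdiff_self, inf_bot_eq]

theorem phi_one_notMem (hb : IsPrimeDecomposition b) (hL : InfPrime (⊥ : L))
    (hι : 1 < Fintype.card ι) : phi 1 ∉ brouwerTheory L := by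
  intro h
  obtain ⟨x, y, hxy⟩ := Fintype.one_lt_card_iff.1 hι
  have := h fun _ => b x
  simp only [phi, if_pos, eval] at this
  have hyx : ¬ b y ≤ b x := fun h => hxy (hb.eq_of_le _ _ h).symm
  rcases hL.2 this.le with h | h
  · exact (hb.prime y).not_isMin
      (isMin_iff_eq_bot.2 (le_bot_iff.1 ((hb.le_top_sdiff_iff.2 hyx).trans h)))
  · refine (hb.prime x).not_isMin (isMin_iff_eq_bot.2 (le_bot_iff.1 (le_trans ?_ h)))
    rw [hb.le_top_sdiff_iff, hb.le_top_sdiff_iff, not_not]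

theorem _root_.Nat.choose_pred_half_lt {n : ℕ} (hn : 2 ≤ n) :
    (n - 1).choose ((n - 1) / 2) < n.choose (n / 2) := by
  obtain ⟨h, rfl | rfl⟩ := n.even_or_odd'
  · obtain ⟨h, rfl⟩ : ∃ j, h = j + 1 := ⟨h - 1, by omega⟩
    rw [show (2 * (h + 1) - 1) / 2 = h by omega, show 2 * (h + 1) / 2 = h + 1 by omega,
      show 2 * (h + 1) - 1 = 2 * h + 1 by omega, show 2 * (h + 1) = (2 * h + 1) + 1 by omega,
      Nat.choose_succ_succ']
    have := Nat.choose_pos (show h + 1 ≤ 2 * h + 1 by omega)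
    omega
  · obtain ⟨h, rfl⟩ : ∃ j, h = j + 1 := ⟨h - 1, by omega⟩
    rw [show (2 * (h + 1) + 1 - 1) / 2 = h + 1 by omega,
      show (2 * (h + 1) + 1) / 2 = h + 1 by omega, Nat.add_sub_cancel, Nat.choose_succ_succ']
    have := Nat.choose_pos (show h ≤ 2 * (h + 1) by omega)
    omega

theorem _root_.Nat.one_lt_choose_half {n : ℕ} (hn : 2 ≤ n) : 1 < n.choose (n / 2) :=
  lt_of_le_of_lt (Nat.choose_pos (Nat.div_le_self _ _)) (Nat.choose_pred_half_lt hn)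

/-- Sperner's theorem for sets that avoid a common point: such an antichain is an antichain of
subsets of a set with one element less. -/
theorem _root_.Finset.card_le_choose_of_antichain_of_notMem [DecidableEq ι]
    {κ : Type*} (s : Finset κ) (T : κ → Finset ι)
    (hT : ∀ i ∈ s, ∀ j ∈ s, i ≠ j → ¬ T i ⊆ T j) (x : ι) (hx : ∀ i ∈ s, x ∉ T i) :
    s.card ≤ (Fintype.card ι - 1).choose ((Fintype.card ι - 1) / 2) := by
  let R : κ → Finset {y : ι // y ≠ x} := fun i => (T i).subtype (· ≠ x)
  have hR : ∀ i ∈ s, ∀ j ∈ s, R i ⊆ R j → i = j := by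
    intro i hi j hj hij
    by_contra hne
    refine hT i hi j hj hne fun y hy => ?_
    have hyx : y ≠ x := fun h => hx i hi (h ▸ hy)
    have : (⟨y, hyx⟩ : {y : ι // y ≠ x}) ∈ R j := hij (Finset.mem_subtype.2 hy)
    exact Finset.mem_subtype.1 this
  have hinj : Set.InjOn R s := fun i hi j hj hij => hR i hi j hj hij.le
  have hanti : IsAntichain (· ⊆ ·) ((s.image R : Finset _) : Set (Finset {y : ι // y ≠ x})) := by
    intro A hA B hB hne hle
    obtain ⟨i, hi, rfl⟩ := Finset.mem_image.1 (Finset.mem_coe.1 hA)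
    obtain ⟨j, hj, rfl⟩ := Finset.mem_image.1 (Finset.mem_coe.1 hB)
    exact hne (congrArg R (hR i hi j hj hle))
  have := hanti.sperner
  rwa [Finset.card_image_of_injOn hinj, Fintype.card_subtype_compl, Fintype.card_subtype_eq]
    at this

theorem phi_choose_mem (hb : IsPrimeDecomposition b) (hι : 1 ≤ Fintype.card ι) :
    phi ((Fintype.card ι).choose (Fintype.card ι / 2)) ∈ brouwerTheory L := by
  classical
  set n := Fintype.card ι with hn
  rcases hι.eq_or_lt with h1 | h1
  · rw [← h1]
    exact hb.phi_one_mem (hn ▸ h1.symm)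
  set k := n.choose (n / 2) with hk
  have hk1 : k ≠ 1 := (Nat.one_lt_choose_half h1).ne'
  intro v
  rw [phi, if_neg hk1, eval]
  by_cases hor : ∃ i ∈ Finset.Icc 1 k, ∃ j ∈ Finset.Icc 1 k, i ≠ j ∧
      negSupport b (v j) ⊆ negSupport b (v i)
  · obtain ⟨i, hi, j, hj, hij, hle⟩ := hor
    rw [eval_bigOr_eq_bot v (a := imp (neg (var i)) (neg (var j))), bot_inf_eq]
    · simp only [Finset.mem_Icc] at hi hj
      refine List.mem_map.2 ⟨(i, j), ?_, rfl⟩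
      simp only [List.mem_filter, List.mem_product, List.mem_range'_1, decide_eq_true_eq]
      omega
    · simp only [eval]
      rw [sdiff_eq_bot_iff, hb.top_sdiff_eq, hb.top_sdiff_eq, hb.sup_le_sup_iff]
      exact hle
  · push Not at hor
    have hcov : ∀ x, ∃ i ∈ Finset.Icc 1 k, x ∈ negSupport b (v i) := by
      intro x
      by_contra! hx
      have := Finset.card_le_choose_of_antichain_of_notMem (Finset.Icc 1 k)
        (fun i => negSupport b (v i)) (fun i hi j hj hij => hor j hj i hi hij.symm) x hx
      rw [Nat.card_Icc, ← hn] at this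
      have := Nat.choose_pred_half_lt h1
      omega
    have : (bigAnd ((List.range' 1 k).map fun i => neg (var i))).eval v = ⊤ := by
      refine _root_.top_le_iff.1 (hb.top_le_iff.2 fun x => ?_)
      obtain ⟨i, hi, hx⟩ := hcov x
      refine le_trans (hb.le_top_sdiff_iff.2 (mem_negSupport.1 hx)) ?_
      refine (eval_bigAnd_le_iff v _).1 le_rfl (neg (var i)) (List.mem_map.2 ⟨i, ?_, rfl⟩)
      simp only [Finset.mem_Icc] at hi
      rw [List.mem_range'_1]
      omega
    rw [eval, this, sdiff_self, inf_bot_eq]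

theorem phi_choose_notMem (hb : IsPrimeDecomposition b) (hL : InfPrime (⊥ : L)) {n : ℕ}
    (hn : 1 ≤ n) (hι : n < Fintype.card ι) :
    phi (n.choose (n / 2)) ∉ brouwerTheory L := by
  classical
  rcases hn.eq_or_lt with rfl | h1
  · exact hb.phi_one_notMem hL hι
  set k := n.choose (n / 2) with hk
  have hk1 : k ≠ 1 := (Nat.one_lt_choose_half h1).ne'
  obtain ⟨U, -, hU⟩ := Finset.exists_subset_card_eq (s := (Finset.univ : Finset ι))
    (n := n) hι.le
  obtain ⟨x, hx⟩ : ∃ x, x ∉ U := by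
    by_contra! h
    have : U = Finset.univ := Finset.eq_univ_of_forall h
    rw [this, Finset.card_univ] at hU
    omega
  let P := Finset.powersetCard (n / 2) U
  have hP : (Finset.Icc 1 k).card = P.card := by
    rw [Finset.card_powersetCard, hU, Nat.card_Icc, Nat.add_sub_cancel]
  -- `T 1, …, T k` enumerates the subsets of `U` with `n / 2` elements
  let e := Finset.equivOfCardEq hP
  let T : ℕ → Finset ι := fun i => if h : i ∈ Finset.Icc 1 k then (e ⟨i, h⟩ : Finset ι) else ∅
  have hTU : ∀ i, T i ⊆ U := by
    intro i
    by_cases h : i ∈ Finset.Icc 1 k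
    · simp only [T, dif_pos h]
      exact (Finset.mem_powersetCard.1 (e ⟨i, h⟩).2).1
    · simp only [T, dif_neg h]
      exact Finset.empty_subset _
  have hanti : ∀ i ∈ Finset.Icc 1 k, ∀ j ∈ Finset.Icc 1 k, T i ⊆ T j → i = j := by
    intro i hi j hj hij
    simp only [T, dif_pos hi, dif_pos hj] at hij
    have := Finset.eq_of_subset_of_card_le hij
      ((Finset.mem_powersetCard.1 (e ⟨j, hj⟩).2).2.trans
        (Finset.mem_powersetCard.1 (e ⟨i, hi⟩).2).2.symm).le
    simpa using e.injective (Subtype.ext this)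
  intro hmem
  have hev := hmem fun i => (T i)ᶜ.sup b
  rw [phi, if_neg hk1, eval] at hev
  rcases hL.2 hev.le with h | h
  · obtain ⟨a, ha, ha0⟩ := exists_eval_eq_bot_of_bigOr _ hL _ (le_bot_iff.1 h)
    obtain ⟨⟨i, j⟩, hij, rfl⟩ := List.mem_map.1 ha
    simp only [List.mem_filter, List.mem_product, List.mem_range'_1, decide_eq_true_eq] at hij
    simp only [eval, sdiff_eq_bot_iff, hb.top_sdiff_sup_compl, hb.sup_le_sup_iff] at ha0
    exact hij.2 (hanti j (Finset.mem_Icc.2 (by omega)) i (Finset.mem_Icc.2 (by omega)) ha0).symm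
  · have hbx := hb.top_le_iff.1 (sdiff_eq_bot_iff.1 (le_bot_iff.1 h)) x
    refine hx (hb.le_sup_iff.1 (hbx.trans ((eval_bigAnd_le_iff _ _).2 fun a ha => ?_)))
    obtain ⟨i, -, rfl⟩ := List.mem_map.1 ha
    simp only [eval, hb.top_sdiff_sup_compl]
    exact hb.sup_le_sup_iff.2 (hTU i)

/-! ### The formulas `σ_n` -/

theorem sigma_mem (hb : IsPrimeDecomposition b) :
    sigma (Fintype.card ι) ∈ brouwerTheory L := by
  intro v
  set n := Fintype.card ι with hn
  rw [sigma, eval, sdiff_eq_bot_iff]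
  set C := eval v (bigAnd ((((List.range (n + 1)) ×ˢ (List.range (n + 1))).filter
    fun q => q.1 < q.2).map fun q => neg (and (neg (var q.1)) (neg (var q.2))))) with hC
  -- an index missing from two of the supports is below the premise
  have hpair : ∀ x, ∀ i ≤ n, ∀ j ≤ n, i < j → b x ≤ v i → b x ≤ v j → b x ≤ C := by
    intro x i hi j hj hij hxi hxj
    refine le_trans ?_ ((eval_bigAnd_le_iff v _).1 le_rfl
      (neg (and (neg (var i)) (neg (var j)))) (List.mem_map.2 ⟨(i, j), ?_, rfl⟩))
    · simp only [eval]
      rw [hb.le_top_sdiff_iff, (hb.prime x).le_sup, hb.le_top_sdiff_iff, hb.le_top_sdiff_iff]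
      tauto
    · simp only [List.mem_filter, List.mem_product, List.mem_range, decide_eq_true_eq]
      omega
  obtain ⟨i, hi, hiC⟩ : ∃ i ≤ n, ∀ x, b x ≤ v i → b x ≤ C := by
    by_contra! hcon
    have : Nonempty ι := ⟨(hcon 0 (Nat.zero_le _)).choose⟩
    choose! x hx hxC using hcon
    obtain ⟨i, hi, j, hj, hij, hxij⟩ := Finset.exists_ne_map_eq_of_card_lt_of_maps_to
      (s := Finset.range (n + 1)) (t := (Finset.univ : Finset ι)) (f := x)
      (by simp [hn]) (fun _ _ => Finset.mem_coe.2 (Finset.mem_univ _))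
    have hi' : i ≤ n := Nat.lt_succ_iff.1 (Finset.mem_range.1 hi)
    have hj' : j ≤ n := Nat.lt_succ_iff.1 (Finset.mem_range.1 hj)
    rcases hij.lt_or_gt with h | h
    · exact hxC i hi' (hpair _ i hi' j hj' h (hx i hi') (hxij ▸ hx j hj'))
    · exact hxC i hi' (hpair _ j hj' i hi' h (hxij ▸ hx j hj') (hx i hi'))
  refine le_trans ((le_eval_bigOr_iff v _).1 le_rfl _ (List.mem_map.2 ⟨i, ?_, rfl⟩)) ?_
  · exact List.mem_range.2 (Nat.lt_succ_iff.2 hi)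
  · rw [eval, sdiff_le_iff]
    refine le_top.trans (hb.top_le_iff.2 fun x => ?_)
    rw [(hb.prime x).le_sup, eval, eval, hb.le_top_sdiff_iff]
    exact (em (b x ≤ v i)).symm.imp_right (hiC x)

theorem sigma_notMem (hb : IsPrimeDecomposition b) (hL : InfPrime (⊥ : L)) {n : ℕ}
    (hι : n < Fintype.card ι) : sigma n ∉ brouwerTheory L := by
  classical
  obtain ⟨x, hx⟩ : ∃ x : ℕ → ι, ∀ i ≤ n, ∀ j ≤ n, x i = x j → i = j := by
    let e := Fintype.equivFin ι
    refine ⟨fun i => e.symm ⟨min i n, by omega⟩, fun i hi j hj hij => ?_⟩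
    have := congrArg Fin.val (e.symm.injective hij)
    simp only at this
    omega
  intro hmem
  have hev := hmem fun i => b (x i)
  -- `¬ p i` is the join of all `b y` with `y ≠ x i`
  rw [sigma, eval, sdiff_eq_bot_iff] at hev
  have hprem := (eval_bigAnd_le_iff (c := ⊥) (fun i => b (x i)) ((((List.range (n + 1)) ×ˢ
    (List.range (n + 1))).filter fun q => q.1 < q.2).map
      fun q => neg (and (neg (var q.1)) (neg (var q.2))))).2 (by
    intro a ha
    obtain ⟨⟨i, j⟩, hij, rfl⟩ := List.mem_map.1 ha
    simp only [List.mem_filter, List.mem_product, List.mem_range, decide_eq_true_eq] at hij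
    simp only [eval]
    rw [hb.top_sdiff_le_iff]
    refine fun y => Or.inl ?_
    rw [(hb.prime y).le_sup, hb.le_top_sdiff_iff, hb.le_top_sdiff_iff, ← not_and_or]
    rintro ⟨h1, h2⟩
    have := hx i (by omega) j (by omega) ((hb.eq_of_le _ _ h1).symm.trans (hb.eq_of_le _ _ h2))
    omega)
  obtain ⟨a, ha, ha0⟩ := exists_eval_eq_bot_of_bigOr _ hL _ (le_bot_iff.1 (hev.trans hprem))
  obtain ⟨i, hi, rfl⟩ := List.mem_map.1 ha
  rw [eval, sdiff_eq_bot_iff] at ha0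
  have hle := (le_eval_bigOr_iff (c := b (x i)) (fun i => b (x i))
      (((List.range (n + 1)).filter fun j => j ≠ i).map fun j => neg (var j))).2 (by
    intro a ha
    obtain ⟨j, hj, rfl⟩ := List.mem_map.1 ha
    simp only [List.mem_filter, List.mem_range, decide_eq_true_eq] at hi hj
    simp only [eval]
    rw [hb.le_top_sdiff_iff]
    exact fun h => hj.2 (hx i (by omega) j (by omega) (hb.eq_of_le _ _ h)).symm)
  have := hle.trans ha0
  rw [eval, eval, hb.le_top_sdiff_iff] at this
  exact this le_rfl

/-- The principal ideal below a join of finitely many incomparable primes. -/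
theorem of_finset_sup {M κ : Type*} [CoheytingAlgebra M] {c : κ → M}
    (hc : ∀ i, SupPrime (c i)) (hle : ∀ i j, c i ≤ c j → i = j) (s : Finset κ) :
    IsPrimeDecomposition fun i : s => (⟨c i, Finset.le_sup i.2⟩ : Set.Iic (s.sup c)) where
  prime i := by
    refine ⟨fun h => (hc i).1 fun x hx => ?_, fun x y h => (hc i).2 h⟩
    exact h (b := ⟨x, hx.trans (Finset.le_sup i.2)⟩) hx
  eq_of_le i j h := Subtype.ext (hle i j h)
  sup_eq_top := by
    refine _root_.top_le_iff.1 (show s.sup c ≤ _ from Finset.sup_le fun i hi => ?_)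
    exact Finset.le_sup (f := fun i : s => (⟨c i, Finset.le_sup i.2⟩ : Set.Iic (s.sup c)))
      (Finset.mem_univ ⟨i, hi⟩)

end IsPrimeDecomposition

theorem InfPrime.bot_Iic {M : Type*} [CoheytingAlgebra M] (hM : InfPrime (⊥ : M)) {A : M}
    (hA : A ≠ ⊥) : InfPrime (⊥ : Set.Iic A) :=
  ⟨fun h => hA (le_bot_iff.1 (h (b := ⊤) bot_le)), fun _ _ h => hM.2 h⟩

theorem var_zero_mem_brouwerTheory_iff {L : Type*} [CoheytingAlgebra L] :
    PropFormula.var 0 ∈ brouwerTheory L ↔ (⊤ : L) = ⊥ :=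
  ⟨fun h => h fun _ => ⊤, fun h _ => le_bot_iff.1 (h ▸ le_top)⟩

/-! ### Turing reducibility and the degrees `𝐁_f` -/

theorem OracleCode.recursiveIn_eval (g : ℕ → ℕ) (c : OracleCode) :
    Nat.RecursiveIn {(g : ℕ →. ℕ)} (eval g c) := by
  induction c with
  | zero => exact .zero
  | succ => exact .succ
  | left => exact .left
  | right => exact .right
  | oracle => exact .oracle _ rfl
  | pair c d ihc ihd =>
    refine (Nat.RecursiveIn.pair ihc ihd).of_eq fun n => ?_
    simp [eval, Seq.seq, Part.bind_map, Part.bind_some_eq_map]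
  | comp c d ihc ihd => exact Nat.RecursiveIn.comp ihc ihd
  | prec c d ihc ihd => exact Nat.RecursiveIn.prec ihc ihd
  | rfind c ih => exact Nat.RecursiveIn.rfind ih

theorem OracleCode.turingReducible_of_eval {g f : ℕ → ℕ} {c : OracleCode}
    (h : ∀ n, eval g c n = Part.some (f n)) :
    TuringReducible (f : ℕ →. ℕ) (g : ℕ →. ℕ) :=
  RecursiveIn.iff_nat.2 ((recursiveIn_eval g c).of_eq h)

theorem TuringReducible.pairFun {g h f : ℕ → ℕ} (hg : TuringReducible (g : ℕ →. ℕ) (f : ℕ →. ℕ))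
    (hh : TuringReducible (h : ℕ →. ℕ) (f : ℕ →. ℕ)) :
    TuringReducible (OracleCode.pairFun g h : ℕ →. ℕ) (f : ℕ →. ℕ) := by
  refine RecursiveIn.iff_nat.2 (((RecursiveIn.iff_nat.1 hg).pair
    (RecursiveIn.iff_nat.1 hh)).of_eq fun n => ?_)
  simp [OracleCode.pairFun, Seq.seq]

namespace MassProblem

open OracleCode

/-- `A` lies above `B_f` as soon as it is contained in it: a reduction applied to a function
computable from `f` yields a function computable from `f`. -/
theorem notReducibleTo_le_iff {f : ℕ → ℕ} {A : MassProblem} :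
    notReducibleTo f ≤ A ↔ ∀ g ∈ A.sols, ¬ TuringReducible (g : ℕ →. ℕ) (f : ℕ →. ℕ) := by
  refine ⟨?_, fun h => Reducible.of_subset h⟩
  rintro ⟨c, hc⟩ g hg hgf
  obtain ⟨f', hf', h⟩ := hc g hg
  exact hf' ((turingReducible_of_eval h).trans hgf)

theorem notReducibleTo_le_join {f : ℕ → ℕ} {A B : MassProblem}
    (h : notReducibleTo f ≤ join A B) : notReducibleTo f ≤ A ∨ notReducibleTo f ≤ B := by
  simp only [notReducibleTo_le_iff] at h ⊢
  by_contra! hcon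
  obtain ⟨⟨g, hg, hgf⟩, g', hg', hgf'⟩ := hcon
  exact h _ ⟨g, hg, g', hg', rfl⟩ (hgf.pairFun hgf')

theorem turingReducible_of_notReducibleTo_le {f g : ℕ → ℕ}
    (h : notReducibleTo f ≤ notReducibleTo g) :
    TuringReducible (f : ℕ →. ℕ) (g : ℕ →. ℕ) := by
  by_contra hfg
  exact notReducibleTo_le_iff.1 h f hfg (TuringReducible.refl _)

theorem not_notReducibleTo_le_bot (f : ℕ → ℕ) : ¬ notReducibleTo f ≤ bot := fun h =>
  notReducibleTo_le_iff.1 h f trivial (TuringReducible.refl _)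

theorem not_top_le_bot : ¬ top ≤ bot := by
  rintro ⟨c, hc⟩
  obtain ⟨_, h, -⟩ := hc (fun _ => 0) trivial
  exact h

/-- A reduction of a meet to `bot` is decided by the first value that it computes from the zero
function, so that one of the two problems has a computable member. -/
theorem meet_le_bot {A B : MassProblem} (h : meet A B ≤ bot) : A ≤ bot ∨ B ≤ bot := by
  have key : ∀ {C : MassProblem} {n : ℕ} {c : OracleCode}, ∀ f ∈ C.sols,
      (∀ k, eval (fun _ => 0) c k = Part.some (consFun n f k)) → C ≤ bot := by
    intro C n c f hf hc
    refine ⟨subst zero (comp c succ), fun g _ => ⟨f, hf, fun k => ?_⟩⟩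
    rw [eval_subst (f := fun _ => 0) fun _ => rfl]
    simp [eval, hc, consFun]
  obtain ⟨c, hc⟩ := h
  obtain ⟨_, ⟨f, hf, rfl⟩ | ⟨f, hf, rfl⟩, h⟩ := hc (fun _ => 0) trivial
  · exact Or.inl (key f hf h)
  · exact Or.inr (key f hf h)

end MassProblem

namespace Medvedev

open MassProblem

theorem infPrime_bot : InfPrime (⊥ : Medvedev) :=
  ⟨fun h => not_top_le_bot (deg_le_deg.1 (h bot_le)),
    fun {a b} => ind (P := fun a => a ⊓ b ≤ ⊥ → a ≤ ⊥ ∨ b ≤ ⊥) (fun A =>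
      ind (P := fun b => deg A ⊓ b ≤ ⊥ → deg A ≤ ⊥ ∨ b ≤ ⊥) (fun _ h => meet_le_bot h) b) a⟩

theorem supPrime_notReducibleTo (f : ℕ → ℕ) : SupPrime (deg (notReducibleTo f)) :=
  ⟨fun h => not_notReducibleTo_le_bot f (deg_le_deg.1 (h bot_le)),
    fun {a b} => ind
      (P := fun a => deg (notReducibleTo f) ≤ a ⊔ b →
        deg (notReducibleTo f) ≤ a ∨ deg (notReducibleTo f) ≤ b)
      (fun A => ind
        (P := fun b => deg (notReducibleTo f) ≤ deg A ⊔ b →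
          deg (notReducibleTo f) ≤ deg A ∨ deg (notReducibleTo f) ≤ b)
        (fun _ h => notReducibleTo_le_join h) b) a⟩

theorem degB_ne_bot (f : ℕ → ℕ → ℕ) {n : ℕ} (hn : 1 ≤ n) : degB f n ≠ ⊥ := fun h =>
  (supPrime_notReducibleTo (f 1)).not_isMin (isMin_iff_eq_bot.2 (le_bot_iff.1
    (h ▸ Finset.le_sup (f := fun i => deg (notReducibleTo (f i)))
      (Finset.mem_Icc.2 ⟨le_rfl, hn⟩))))

end Medvedev

/-- Let `f₀, f₁, …` have pairwise incomparable Turing degrees. The theories of the initial segments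
`𝔐/𝐁_m` and `𝔐/𝐁_n` of the Medvedev lattice differ for `m ≠ n`; for `1 ≤ n < m` they are separated
by `φ_k` with `k = C(n, ⌊n/2⌋)`, and also by `σ_n`. -/
theorem mainTheorem5 (f : ℕ → ℕ → ℕ)
    (hf : ∀ i j : ℕ, i ≠ j → ¬ TuringReducible (f i : ℕ →. ℕ) (f j : ℕ →. ℕ)) :
    (∀ m n : ℕ, m ≠ n →
      brouwerTheory (Set.Iic (Medvedev.degB f m)) ≠ brouwerTheory (Set.Iic (Medvedev.degB f n))) ∧
    (∀ m n : ℕ, 1 ≤ n → n < m →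
      PropFormula.phi (n.choose (n / 2)) ∈ brouwerTheory (Set.Iic (Medvedev.degB f n)) ∧
      PropFormula.phi (n.choose (n / 2)) ∉ brouwerTheory (Set.Iic (Medvedev.degB f m)) ∧
      PropFormula.sigma n ∈ brouwerTheory (Set.Iic (Medvedev.degB f n)) ∧
      PropFormula.sigma n ∉ brouwerTheory (Set.Iic (Medvedev.degB f m))) := by
  have hle : ∀ i j, Medvedev.deg (MassProblem.notReducibleTo (f i)) ≤
      Medvedev.deg (MassProblem.notReducibleTo (f j)) → i = j := fun i j h => by
    by_contra hij
    exact hf i j hij (MassProblem.turingReducible_of_notReducibleTo_le h)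
  have hdec : ∀ n, IsPrimeDecomposition fun i : Finset.Icc 1 n =>
      (⟨Medvedev.deg (MassProblem.notReducibleTo (f i)),
        Finset.le_sup (f := fun i => Medvedev.deg (MassProblem.notReducibleTo (f i))) i.2⟩ :
        Set.Iic (Medvedev.degB f n)) := fun n =>
    .of_finset_sup (fun i => Medvedev.supPrime_notReducibleTo (f i)) hle (Finset.Icc 1 n)
  have hcard : ∀ n, Fintype.card (Finset.Icc 1 n) = n := fun n => by simp
  have hsep : ∀ m n : ℕ, 1 ≤ n → n < m →
      PropFormula.phi (n.choose (n / 2)) ∈ brouwerTheory (Set.Iic (Medvedev.degB f n)) ∧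
      PropFormula.phi (n.choose (n / 2)) ∉ brouwerTheory (Set.Iic (Medvedev.degB f m)) ∧
      PropFormula.sigma n ∈ brouwerTheory (Set.Iic (Medvedev.degB f n)) ∧
      PropFormula.sigma n ∉ brouwerTheory (Set.Iic (Medvedev.degB f m)) := by
    intro m n hn hnm
    have hbot := Medvedev.infPrime_bot.bot_Iic (Medvedev.degB_ne_bot f (hn.trans hnm.le))
    have hphi := (hdec n).phi_choose_mem ((hcard n).symm ▸ hn)
    have hsigma := (hdec n).sigma_mem
    rw [hcard n] at hphi hsigma
    exact ⟨hphi, (hdec m).phi_choose_notMem hbot hn ((hcard m).symm ▸ hnm), hsigma,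
      (hdec m).sigma_notMem hbot ((hcard m).symm ▸ hnm)⟩
  refine ⟨fun m n hmn => ?_, hsep⟩
  wlog hlt : n < m generalizing m n
  · exact (this n m hmn.symm (by omega)).symm
  rcases Nat.eq_zero_or_pos n with rfl | hn
  · -- the algebra is trivial exactly for `n = 0`, which a single variable detects
    intro h
    have h0 : PropFormula.var 0 ∈ brouwerTheory (Set.Iic (Medvedev.degB f 0)) :=
      var_zero_mem_brouwerTheory_iff.2 (Subtype.ext (by simp [Medvedev.degB]; rfl))
    rw [← h, var_zero_mem_brouwerTheory_iff] at h0
    exact Medvedev.degB_ne_bot f hlt (congrArg Subtype.val h0)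
  · intro h
    obtain ⟨-, -, hmem, hnot⟩ := hsep m n hn hlt
    exact hnot (h ▸ hmem)
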